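/- Let $\mathbb D\subset\mathbb C$ be the open unit disc and let $\mathbb B_n=\{z\in\mathbb C^n:|z_1|^2+\dots+|z_n|^2<1\}$ be the open Euclidean unit ball. A holomorphic map $f:\mathbb D\to\mathbb B_n$ is called an *$m$-extremal* if for any pairwise distinct points $\lambda_1,\dots,\lambda_m\in\mathbb D$ there is no map $h$, holomorphic in a neighborhood of $\overline{\mathbb D}$ with values in $\mathbb B_n$, such that $h(\lambda_j)=f(\lambda_j)$ for $j=1,\dots,m$. It is called an *$m$-geodesic* if there is a holomorphic function $F:\mathbb B_n\to\mathbb D$ such that $F\circ f$ is a non-constant finite Blaschke product of degree at most $m-1$, that is, $F\circ f$ is non-constant and $$F(f(\lambda))=\zeta\prod_{j=1}^{k}\frac{\lambda-\alpha_j}{1-\overline{\alpha_j}\lambda},\qquad\lambda\in\mathbb D,$$ for some $0\le k\le m-1$, $\alpha_1,\dots,\alpha_k\in\mathbb D$ and $\zeta\in\mathbb C$ with $|\zeta|=1$. **Theorem.** For every $n$, any $3$-extremal $f:\mathbb D\to\mathbb B_n$ is a $3$-geodesic. -/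

import Mathlib

namespace BallExtremals

/-- The open unit disc in `ℂ`. -/
abbrev disc : Set ℂ := Metric.ball (0 : ℂ) 1

/-- The open Euclidean unit ball in `ℂⁿ`. -/
abbrev unitBall (n : ℕ) : Set (EuclideanSpace ℂ (Fin n)) :=
  Metric.ball (0 : EuclideanSpace ℂ (Fin n)) 1

/-- `f` is a holomorphic map from the open unit disc to `D`.
Only the values of `f` on the disc matter. -/
def IsHolDisc {n : ℕ} (D : Set (EuclideanSpace ℂ (Fin n)))
    (f : ℂ → EuclideanSpace ℂ (Fin n)) : Prop :=
  DifferentiableOn ℂ f disc ∧ Set.MapsTo f disc D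

/-- `h` is holomorphic in an open neighbourhood of the closed unit disc, with values in `D`. -/
def IsHolClosedDisc {n : ℕ} (D : Set (EuclideanSpace ℂ (Fin n)))
    (h : ℂ → EuclideanSpace ℂ (Fin n)) : Prop :=
  ∃ U : Set ℂ, IsOpen U ∧ Metric.closedBall (0 : ℂ) 1 ⊆ U ∧
    DifferentiableOn ℂ h U ∧ Set.MapsTo h U D

/-- `f` is a weak `m`-extremal of `D` for the points `lam 0, …, lam (m - 1)`: it is a holomorphic
map from the disc to `D`, and no map that is holomorphic in a neighbourhood of the closed disc with
values in `D` agrees with `f` at all these points. (The points are meant to be distinct points of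
the disc, as they are in `IsExtremal`.) -/
def IsWeakExtremalFor {n : ℕ} (D : Set (EuclideanSpace ℂ (Fin n))) {m : ℕ} (lam : Fin m → ℂ)
    (f : ℂ → EuclideanSpace ℂ (Fin n)) : Prop :=
  IsHolDisc D f ∧
    ¬ ∃ h : ℂ → EuclideanSpace ℂ (Fin n), IsHolClosedDisc D h ∧ ∀ j, h (lam j) = f (lam j)

/-- `f` is an `m`-extremal of `D`: a holomorphic map from the disc to `D` that is a weak
`m`-extremal for every choice of `m` pairwise distinct points of the disc. -/
def IsExtremal (m : ℕ) {n : ℕ} (D : Set (EuclideanSpace ℂ (Fin n)))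
    (f : ℂ → EuclideanSpace ℂ (Fin n)) : Prop :=
  IsHolDisc D f ∧
    ∀ lam : Fin m → ℂ, Function.Injective lam → (∀ j, lam j ∈ disc) → IsWeakExtremalFor D lam f

/-- The Möbius function `m_α(z) = (z - α) / (1 - conj α * z)`. -/
noncomputable def moebius (α z : ℂ) : ℂ := (z - α) / (1 - (starRingEnd ℂ) α * z)

/-- On the unit disc, `B` is a finite Blaschke product of degree `k`:
`B = ζ ∏_{j=1}^k m_{α_j}` with `|ζ| = 1` and all `α_j` in the unit disc. -/
def IsBlaschkeProduct (k : ℕ) (B : ℂ → ℂ) : Prop :=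
  ∃ (ζ : ℂ) (α : Fin k → ℂ), ‖ζ‖ = 1 ∧ (∀ j, α j ∈ disc) ∧
    ∀ z ∈ disc, B z = ζ * ∏ j, moebius (α j) z

/-- `F` is an `m`-left inverse of `f`: a holomorphic function from `D` to the unit disc such that
`F ∘ f` is a non-constant finite Blaschke product of degree at most `m - 1`. -/
def IsLeftInverse (m : ℕ) {n : ℕ} (D : Set (EuclideanSpace ℂ (Fin n)))
    (f : ℂ → EuclideanSpace ℂ (Fin n)) (F : EuclideanSpace ℂ (Fin n) → ℂ) : Prop :=
  DifferentiableOn ℂ F D ∧ Set.MapsTo F D disc ∧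
    (∃ k : ℕ, k + 1 ≤ m ∧ IsBlaschkeProduct k (F ∘ f)) ∧
    ¬ ∃ c : ℂ, ∀ z ∈ disc, (F ∘ f) z = c

/-- `f` is an `m`-geodesic of `D`: a holomorphic map from the disc to `D` that has an
`m`-left inverse. -/
def IsGeodesic (m : ℕ) {n : ℕ} (D : Set (EuclideanSpace ℂ (Fin n)))
    (f : ℂ → EuclideanSpace ℂ (Fin n)) : Prop :=
  IsHolDisc D f ∧ ∃ F : EuclideanSpace ℂ (Fin n) → ℂ, IsLeftInverse m D f F

end BallExtremals

namespace BallExtremals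

/-! Two Schur steps reduce `f` to a quadratic normal form that has an explicit left inverse. Write
φ_a for the ball involution exchanging `a` and 0; its formula uses a/(1+s), s = √(1-‖a‖²), in place
of projections, so a = 0 is no special case. By Schwarz, φ_{f(0)} ∘ f = z g(z), with g a constant
unit vector or a map into the ball. In the second case put c = g(1/2); again φ_c ∘ g = m(z) k(m(z))
with m = m_{1/2}. If k mapped into the ball, freezing it at one value would give a competitor
through 0, 1/2 and -1/2, against extremality for these points (the only ones needed). So k is a
constant unit vector (`IsExtremal.exists_schur_form`).

Then g is a complex geodesic, g = p + m_α e with p ⟂ e and ‖p‖² + ‖e‖² = 1. A further involution, at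
a well-chosen point of the curve z g(z), turns it into ν x + ν² y with ν = m_β(z), x ⟂ y and ‖x‖² +
‖y‖² = 1 (`exists_quadratic_normal_form`). On that curve (⟨x/‖x‖, ·⟩² + 2⟨y, ·⟩)/(1 + ‖y‖²) equals
ν², a Blaschke product of degree 2. If g is constant, a linear functional gives degree 1. -/

theorem sqrt_one_sub_norm_sq_pos {E : Type*} [SeminormedAddCommGroup E] {a : E} (ha : ‖a‖ < 1) : 0 < √(1 - ‖a‖ ^ 2) :=
  Real.sqrt_pos.mpr (by nlinarith [norm_nonneg a])

theorem sq_sqrt_one_sub_norm_sq {E : Type*} [SeminormedAddCommGroup E] {a : E} (ha : ‖a‖ < 1) :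
    √(1 - ‖a‖ ^ 2) ^ 2 = 1 - ‖a‖ ^ 2 :=
  Real.sq_sqrt (by nlinarith [norm_nonneg a])

/-! ### Involutions of the ball and orthogonality -/

section Involution

variable {E : Type*} [NormedAddCommGroup E] [InnerProductSpace ℂ E]

/-- The involutive automorphism of the open unit ball that exchanges `a` and `0`. -/
noncomputable def ballInvolution (a z : E) : E :=
  (((1 + √(1 - ‖a‖ ^ 2))⁻¹ : ℝ) : ℂ) • a +
    ((√(1 - ‖a‖ ^ 2) : ℝ) / (1 - inner ℂ a z) : ℂ) •
      ((((1 + √(1 - ‖a‖ ^ 2))⁻¹ : ℝ) : ℂ) • a - z)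

theorem one_sub_inner_ne_zero {a z : E} (ha : ‖a‖ < 1) (hz : ‖z‖ ≤ 1) :
    (1 : ℂ) - inner ℂ a z ≠ 0 := by
  intro h
  have h1 : inner ℂ a z = (1 : ℂ) := (sub_eq_zero.mp h).symm
  have h2 := norm_inner_le_norm (𝕜 := ℂ) a z
  rw [h1, norm_one] at h2
  nlinarith [norm_nonneg a, norm_nonneg z]

theorem inner_self_eq_one_sub {a : E} (ha : ‖a‖ < 1) :
    inner ℂ a a = 1 - (√(1 - ‖a‖ ^ 2) : ℂ) ^ 2 := by
  have h := sq_sqrt_one_sub_norm_sq ha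
  have h2 : ((√(1 - ‖a‖ ^ 2) ^ 2 : ℝ) : ℂ) = ((1 - ‖a‖ ^ 2 : ℝ) : ℂ) := by rw [h]
  push_cast at h2
  rw [h2, inner_self_eq_norm_sq_to_K]
  simp

theorem inner_ballInvolution {a z : E} (ha : ‖a‖ < 1) (hz : (1 : ℂ) - inner ℂ a z ≠ 0) :
    inner ℂ a (ballInvolution a z) =
      1 - (√(1 - ‖a‖ ^ 2) : ℂ) ^ 2 / (1 - inner ℂ a z) := by
  have hs := sqrt_one_sub_norm_sq_pos ha
  have hs1 : (1 + (√(1 - ‖a‖ ^ 2) : ℂ)) ≠ 0 := by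
    exact_mod_cast (by positivity : 1 + √(1 - ‖a‖ ^ 2) ≠ 0)
  simp only [ballInvolution, inner_add_right, inner_smul_right, inner_sub_right,
    inner_self_eq_one_sub ha]
  push_cast
  generalize (√(1 - ‖a‖ ^ 2) : ℂ) = s at *
  field_simp
  ring

theorem ballInvolution_ballInvolution {a z : E} (ha : ‖a‖ < 1)
    (hz : (1 : ℂ) - inner ℂ a z ≠ 0) :
    ballInvolution a (ballInvolution a z) = z := by
  have hs := sqrt_one_sub_norm_sq_pos ha
  have hs0 : (√(1 - ‖a‖ ^ 2) : ℂ) ≠ 0 := by exact_mod_cast hs.ne'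
  rw [ballInvolution, inner_ballInvolution ha hz, ballInvolution]
  generalize (√(1 - ‖a‖ ^ 2) : ℂ) = s at *
  generalize (((1 + √(1 - ‖a‖ ^ 2))⁻¹ : ℝ) : ℂ) • a = X
  have h1 : s / (1 - (1 - s ^ 2 / (1 - inner ℂ a z))) = (1 - inner ℂ a z) / s := by
    field_simp
    ring_nf
  have h2 : (1 - inner ℂ a z) / s * (s / (1 - inner ℂ a z)) = 1 := by field_simp
  rw [h1, sub_add_cancel_left, smul_neg, smul_smul, h2, one_smul]
  abel

theorem ballInvolution_self {a : E} (ha : ‖a‖ < 1) : ballInvolution a a = 0 := by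
  have hs := sqrt_one_sub_norm_sq_pos ha
  have hs0 : (√(1 - ‖a‖ ^ 2) : ℂ) ≠ 0 := by exact_mod_cast hs.ne'
  have hs1 : (1 + (√(1 - ‖a‖ ^ 2) : ℂ)) ≠ 0 := by
    exact_mod_cast (by positivity : 1 + √(1 - ‖a‖ ^ 2) ≠ 0)
  rw [ballInvolution, inner_self_eq_one_sub ha]
  push_cast
  generalize (√(1 - ‖a‖ ^ 2) : ℂ) = s at *
  match_scalars
  field_simp
  ring

/-- The sign of the right side shows that both the open ball and the unit sphere are preserved. -/
theorem one_sub_norm_ballInvolution_sq {a z : E} (ha : ‖a‖ < 1)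
    (hz : (1 : ℂ) - inner ℂ a z ≠ 0) :
    1 - ‖ballInvolution a z‖ ^ 2 =
      (1 - ‖a‖ ^ 2) * (1 - ‖z‖ ^ 2) / ‖(1 : ℂ) - inner ℂ a z‖ ^ 2 := by
  have hs := sqrt_one_sub_norm_sq_pos ha
  have hs2 := sq_sqrt_one_sub_norm_sq ha
  have hs1 : 1 + √(1 - ‖a‖ ^ 2) ≠ 0 := by positivity
  have hD : ‖(1 : ℂ) - inner ℂ a z‖ ^ 2 ≠ 0 := by simpa using hz
  have hDn : ‖(1 : ℂ) - inner ℂ a z‖ ^ 2 = (1 - (inner ℂ a z).re) ^ 2 + (inner ℂ a z).im ^ 2 := by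
    rw [← Complex.normSq_eq_norm_sq, Complex.normSq_apply]
    simp
    ring
  have ha2 : ‖a‖ ^ 2 = 1 - √(1 - ‖a‖ ^ 2) ^ 2 := by linarith
  have hX : ‖(((1 + √(1 - ‖a‖ ^ 2))⁻¹ : ℝ) : ℂ) • a‖ ^ 2 =
      (1 - √(1 - ‖a‖ ^ 2)) / (1 + √(1 - ‖a‖ ^ 2)) := by
    rw [norm_smul, mul_pow, Complex.norm_real, Real.norm_eq_abs, sq_abs]
    generalize √(1 - ‖a‖ ^ 2) = s at *
    rw [ha2]
    field_simp
    ring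
  have hXz : inner ℂ ((((1 + √(1 - ‖a‖ ^ 2))⁻¹ : ℝ) : ℂ) • a) z =
      (((1 + √(1 - ‖a‖ ^ 2))⁻¹ : ℝ) : ℂ) * inner ℂ a z := by
    rw [inner_smul_left, Complex.conj_ofReal]
  rw [eq_div_iff hD, hDn, ballInvolution]
  generalize (((1 + √(1 - ‖a‖ ^ 2))⁻¹ : ℝ) : ℂ) • a = X at *
  rw [norm_add_sq (𝕜 := ℂ), norm_smul, mul_pow,
    norm_sub_sq (𝕜 := ℂ), inner_smul_right, inner_sub_right, hXz, inner_self_eq_norm_sq_to_K,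
    norm_div, div_pow, Complex.norm_real, Real.norm_eq_abs, sq_abs, ← RCLike.ofReal_pow, hX,
    div_eq_mul_inv (Complex.ofReal _), Complex.inv_def, Complex.normSq_eq_norm_sq, hDn]
  rw [hDn] at hD
  generalize √(1 - ‖a‖ ^ 2) = s at *
  rw [← hs2]
  generalize inner ℂ a z = w at *
  simp only [RCLike.re_to_complex, Complex.coe_algebraMap,
    Complex.mul_re, Complex.mul_im, Complex.ofReal_re,
    Complex.ofReal_im, Complex.sub_re, Complex.sub_im, Complex.conj_re, Complex.conj_im,
    Complex.one_re, Complex.one_im]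
  field_simp
  ring

theorem norm_ballInvolution_lt_one {a z : E} (ha : ‖a‖ < 1) (hz : ‖z‖ < 1) :
    ‖ballInvolution a z‖ < 1 := by
  have hD := one_sub_inner_ne_zero ha hz.le
  have h := one_sub_norm_ballInvolution_sq ha hD
  have h1 : 0 < (1 - ‖a‖ ^ 2) * (1 - ‖z‖ ^ 2) / ‖(1 : ℂ) - inner ℂ a z‖ ^ 2 := by
    have : 0 < 1 - ‖a‖ ^ 2 := by nlinarith [norm_nonneg a]
    have : 0 < 1 - ‖z‖ ^ 2 := by nlinarith [norm_nonneg z]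
    have : 0 < ‖(1 : ℂ) - inner ℂ a z‖ := norm_pos_iff.mpr hD
    positivity
  rw [← h] at h1
  nlinarith [norm_nonneg (ballInvolution a z)]

theorem norm_ballInvolution_eq_one {a z : E} (ha : ‖a‖ < 1) (hz : ‖z‖ = 1) :
    ‖ballInvolution a z‖ = 1 := by
  have h := one_sub_norm_ballInvolution_sq ha (one_sub_inner_ne_zero ha hz.le)
  rw [hz] at h
  have : ‖ballInvolution a z‖ ^ 2 = 1 := by
    simp at h
    linarith
  exact (pow_eq_one_iff_of_nonneg (norm_nonneg _) two_ne_zero).mp this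

theorem differentiableOn_ballInvolution {a : E} (ha : ‖a‖ < 1) :
    DifferentiableOn ℂ (ballInvolution a) (Metric.ball 0 1) := by
  intro z hz
  have hD := one_sub_inner_ne_zero ha (mem_ball_zero_iff.mp hz).le
  have hi : DifferentiableAt ℂ (fun z => inner ℂ a z) z :=
    (innerSL ℂ a).differentiableAt
  have hD' : DifferentiableAt ℂ (fun z => (1 : ℂ) - inner ℂ a z) z :=
    (differentiableAt_const _).sub hi
  have hq : DifferentiableAt ℂ
      (fun z => ((√(1 - ‖a‖ ^ 2) : ℝ) / (1 - inner ℂ a z) : ℂ)) z := by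
    simpa only [div_eq_mul_inv] using (hD'.fun_inv hD).const_mul _
  exact ((differentiableAt_const _).add
    (hq.smul ((differentiableAt_const _).sub differentiableAt_id))).differentiableWithinAt

/-- The squared norm is a trigonometric polynomial in ν; the values at 1, -1 and i already determine
its coefficients. -/
theorem inner_eq_zero_of_norm_add_smul_eq_one {x y : E}
    (h : ∀ ν : ℂ, ‖ν‖ = 1 → ‖x + ν • y‖ = 1) :
    inner ℂ x y = 0 ∧ ‖x‖ ^ 2 + ‖y‖ ^ 2 = 1 := by
  have key : ∀ ν : ℂ, ‖ν‖ = 1 → ‖x‖ ^ 2 + 2 * (ν * inner ℂ x y).re + ‖y‖ ^ 2 = 1 := by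
    intro ν hν
    have := norm_add_sq (𝕜 := ℂ) x (ν • y)
    rw [h ν hν, norm_smul, hν, inner_smul_right, RCLike.re_to_complex] at this
    ring_nf at this ⊢
    linarith
  have h1 := key 1 (by simp)
  have h2 := key (-1) (by simp)
  have h3 := key Complex.I (by simp)
  simp at h1 h2 h3
  exact ⟨Complex.ext (by simp only [Complex.zero_re]; linarith)
    (by simp only [Complex.zero_im]; linarith), by linarith⟩

/-- Bessel's inequality. Norms at most 1 are allowed so that normalising a zero vector, which gives
0, does no harm. -/
theorem norm_inner_sq_add_norm_inner_sq_le {x y : E} (hx : ‖x‖ ≤ 1) (hy : ‖y‖ ≤ 1)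
    (hxy : inner ℂ x y = 0) (z : E) :
    ‖(inner ℂ x z : ℂ)‖ ^ 2 + ‖(inner ℂ y z : ℂ)‖ ^ 2 ≤ ‖z‖ ^ 2 := by
  set p : ℂ := inner ℂ x z with hp
  set q : ℂ := inner ℂ y z with hq
  have h0 : 0 ≤ ‖z - (p • x + q • y)‖ ^ 2 := by positivity
  have hpz : inner ℂ z x = (starRingEnd ℂ) p := by rw [hp, inner_conj_symm]
  have hqz : inner ℂ z y = (starRingEnd ℂ) q := by rw [hq, inner_conj_symm]
  rw [norm_sub_sq (𝕜 := ℂ), norm_add_sq (𝕜 := ℂ), inner_add_right, inner_smul_right,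
    inner_smul_right, inner_smul_left, inner_smul_right, hxy, hpz, hqz, norm_smul, norm_smul,
    Complex.mul_conj, Complex.mul_conj, Complex.normSq_eq_norm_sq, Complex.normSq_eq_norm_sq]
    at h0
  simp only [RCLike.re_to_complex, mul_zero, Complex.zero_re, Complex.add_re, Complex.ofReal_re,
    add_zero, mul_pow] at h0
  have hx2 : ‖p‖ ^ 2 * ‖x‖ ^ 2 ≤ ‖p‖ ^ 2 :=
    mul_le_of_le_one_right (by positivity) (pow_le_one₀ (norm_nonneg _) hx)
  have hy2 : ‖q‖ ^ 2 * ‖y‖ ^ 2 ≤ ‖q‖ ^ 2 :=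
    mul_le_of_le_one_right (by positivity) (pow_le_one₀ (norm_nonneg _) hy)
  linarith

end Involution

/-! ### Möbius functions of the disc -/

theorem one_sub_conj_mul_ne_zero {α z : ℂ} (hα : ‖α‖ < 1) (hz : ‖z‖ ≤ 1) :
    1 - (starRingEnd ℂ) α * z ≠ 0 := by
  simpa [mul_comm] using one_sub_inner_ne_zero hα hz

theorem one_sub_mul_conj_ne_zero {α z : ℂ} (hα : ‖α‖ < 1) (hz : ‖z‖ ≤ 1) :
    1 - z * (starRingEnd ℂ) α ≠ 0 := by
  simpa using one_sub_inner_ne_zero hα hz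

/-- The case E = ℂ of the involution, through which the norm estimates carry over to the disc. -/
theorem moebius_eq_neg_ballInvolution {α z : ℂ} (hα : ‖α‖ < 1) (hz : ‖z‖ ≤ 1) :
    moebius α z = -ballInvolution α z := by
  have hs := sqrt_one_sub_norm_sq_pos hα
  have hD := one_sub_conj_mul_ne_zero hα hz
  have hD' := one_sub_mul_conj_ne_zero hα hz
  have hs1 : (1 + (√(1 - ‖α‖ ^ 2) : ℂ)) ≠ 0 := by
    exact_mod_cast (by positivity : 1 + √(1 - ‖α‖ ^ 2) ≠ 0)
  have hs2 := inner_self_eq_one_sub hα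
  rw [moebius, ballInvolution]
  simp only [RCLike.inner_apply, smul_eq_mul] at *
  push_cast
  generalize (√(1 - ‖α‖ ^ 2) : ℂ) = s at *
  rw [mul_comm z]
  field_simp
  linear_combination (-z) * hs2

theorem norm_moebius_lt_one {α z : ℂ} (hα : ‖α‖ < 1) (hz : ‖z‖ < 1) : ‖moebius α z‖ < 1 := by
  rw [moebius_eq_neg_ballInvolution hα hz.le, norm_neg]
  exact norm_ballInvolution_lt_one hα hz

theorem norm_moebius_eq_one {α z : ℂ} (hα : ‖α‖ < 1) (hz : ‖z‖ = 1) : ‖moebius α z‖ = 1 := by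
  rw [moebius_eq_neg_ballInvolution hα hz.le, norm_neg]
  exact norm_ballInvolution_eq_one hα hz

theorem norm_moebius_le_one {α z : ℂ} (hα : ‖α‖ < 1) (hz : ‖z‖ ≤ 1) : ‖moebius α z‖ ≤ 1 :=
  hz.lt_or_eq.elim (fun h => (norm_moebius_lt_one hα h).le) fun h => (norm_moebius_eq_one hα h).le

theorem differentiableAt_moebius {α z : ℂ} (hz : 1 - (starRingEnd ℂ) α * z ≠ 0) :
    DifferentiableAt ℂ (moebius α) z := by
  unfold moebius
  fun_prop (disch := exact hz)

theorem differentiableOn_moebius {α : ℂ} (hα : ‖α‖ < 1) :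
    DifferentiableOn ℂ (moebius α) disc := fun _ hz =>
  (differentiableAt_moebius
    (one_sub_conj_mul_ne_zero hα (mem_ball_zero_iff.mp hz).le)).differentiableWithinAt

theorem moebius_neg_moebius {α z : ℂ} (hα : ‖α‖ < 1) (hz : ‖z‖ ≤ 1) :
    moebius (-α) (moebius α z) = z := by
  have hD := one_sub_conj_mul_ne_zero hα hz
  have hD' := one_sub_mul_conj_ne_zero hα hz
  have hα2 := one_sub_conj_mul_ne_zero hα hα.le
  simp only [moebius, map_neg]
  have h1 : (z - α) / (1 - (starRingEnd ℂ) α * z) - -α =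
      z * (1 - (starRingEnd ℂ) α * α) / (1 - (starRingEnd ℂ) α * z) := by
    field_simp
    ring
  have h2 : 1 - -(starRingEnd ℂ) α * ((z - α) / (1 - (starRingEnd ℂ) α * z)) =
      (1 - (starRingEnd ℂ) α * α) / (1 - (starRingEnd ℂ) α * z) := by
    field_simp
    ring
  rw [h1, h2, div_div_div_cancel_right₀ hD, mul_div_cancel_right₀ _ hα2]

theorem moebius_moebius_neg {α z : ℂ} (hα : ‖α‖ < 1) (hz : ‖z‖ ≤ 1) :
    moebius α (moebius (-α) z) = z := by
  simpa using moebius_neg_moebius (α := -α) (by simpa using hα) hz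

theorem moebius_self (α : ℂ) : moebius α α = 0 := by simp [moebius]

/-- The composition of two Möbius functions is a Möbius function up to a unimodular factor. -/
theorem exists_moebius_comp {w δ : ℂ} (hw : ‖w‖ < 1) (hδ : ‖δ‖ < 1) :
    ∃ α ζ : ℂ, ‖α‖ < 1 ∧ ‖ζ‖ = 1 ∧
      ∀ z, ‖z‖ ≤ 1 → moebius w (moebius δ z) = ζ * moebius α z := by
  have hw' : ‖-w‖ < 1 := by simpa using hw
  have hk := one_sub_conj_mul_ne_zero hw' hδ.le
  have hk' : 1 + w * (starRingEnd ℂ) δ ≠ 0 := by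
    have := (map_ne_zero (starRingEnd ℂ)).mpr hk
    simpa using this
  have hk2 : 1 + (starRingEnd ℂ) w * δ ≠ 0 := by simpa using hk
  have hζ : ‖(1 + w * (starRingEnd ℂ) δ) / (1 + (starRingEnd ℂ) w * δ)‖ = 1 := by
    rw [norm_div, div_eq_one_iff_eq (norm_ne_zero_iff.mpr hk2), ← Complex.norm_conj]
    simp
  have hα : ‖(δ + w) / (1 + w * (starRingEnd ℂ) δ)‖ < 1 := by
    have h := norm_moebius_lt_one hw' hδ
    have e : moebius (-w) δ = (δ + w) / (1 + w * (starRingEnd ℂ) δ) *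
        ((1 + w * (starRingEnd ℂ) δ) / (1 + (starRingEnd ℂ) w * δ)) := by
      simp only [moebius, map_neg, sub_neg_eq_add, neg_mul]
      field_simp
    rwa [e, norm_mul, hζ, mul_one] at h
  refine ⟨_, _, hα, hζ, fun z hz => ?_⟩
  have hD := one_sub_conj_mul_ne_zero hδ hz
  have hD' := one_sub_mul_conj_ne_zero hδ hz
  have hD3 := one_sub_conj_mul_ne_zero hα hz
  have e2 : 1 - (starRingEnd ℂ) w * moebius δ z =
      (1 + (starRingEnd ℂ) w * δ - ((starRingEnd ℂ) δ + (starRingEnd ℂ) w) * z) /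
        (1 - (starRingEnd ℂ) δ * z) := by
    rw [moebius]
    field_simp
    ring
  have e1 : moebius δ z - w =
      ((1 + w * (starRingEnd ℂ) δ) * z - (δ + w)) / (1 - (starRingEnd ℂ) δ * z) := by
    rw [moebius]
    field_simp
    ring
  have e3 : 1 - (starRingEnd ℂ) ((δ + w) / (1 + w * (starRingEnd ℂ) δ)) * z =
      (1 + (starRingEnd ℂ) w * δ - ((starRingEnd ℂ) δ + (starRingEnd ℂ) w) * z) /
        (1 + (starRingEnd ℂ) w * δ) := by
    simp only [map_div₀, map_add, map_one, map_mul, Complex.conj_conj]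
    field_simp
  have hN : 1 + (starRingEnd ℂ) w * δ - ((starRingEnd ℂ) δ + (starRingEnd ℂ) w) * z ≠ 0 := by
    intro h
    rw [e3, h, zero_div] at hD3
    exact hD3 rfl
  have e4 : z - (δ + w) / (1 + w * (starRingEnd ℂ) δ) =
      ((1 + w * (starRingEnd ℂ) δ) * z - (δ + w)) / (1 + w * (starRingEnd ℂ) δ) := by
    field_simp
  rw [moebius, e1, e2, moebius, e3, e4, div_div_div_cancel_right₀ hD]
  generalize 1 + (starRingEnd ℂ) w * δ - ((starRingEnd ℂ) δ + (starRingEnd ℂ) w) * z = N at *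
  generalize 1 + (starRingEnd ℂ) w * δ = k at *
  generalize 1 + w * (starRingEnd ℂ) δ = l at *
  field_simp

/-! ### Normal forms of the extremal curves -/

section Forms

variable {E : Type*} [NormedAddCommGroup E] [InnerProductSpace ℂ E]

/-- Every complex geodesic of the ball is affine in a suitable Möbius parameter. -/
theorem exists_ballInvolution_moebius_smul_eq {c v : E} {δ : ℂ} (hc : ‖c‖ < 1) (hv : ‖v‖ = 1)
    (hδ : ‖δ‖ < 1) :
    ∃ (p e : E) (α : ℂ), ‖α‖ < 1 ∧ inner ℂ p e = 0 ∧ ‖p‖ ^ 2 + ‖e‖ ^ 2 = 1 ∧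
      ∀ z, ‖z‖ ≤ 1 → ballInvolution c (moebius δ z • v) = p + moebius α z • e := by
  set w : ℂ := (starRingEnd ℂ) (inner ℂ c v) with hw_def
  have hcv : inner ℂ c v = (starRingEnd ℂ) w := by simp [hw_def]
  have hw : ‖w‖ < 1 := by
    rw [hw_def, Complex.norm_conj]
    have := norm_inner_le_norm (𝕜 := ℂ) c v
    rw [hv, mul_one] at this
    exact this.trans_lt hc
  have hw' : ‖-w‖ < 1 := by simpa using hw
  have hk := one_sub_conj_mul_ne_zero hw hw.le
  -- In the parameter μ the denominator of the involution is (1-|w|²)/(1 + w̄μ); its reciprocal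
  -- cancels the denominator of m_{-w}(μ), so the curve is affine in μ.
  obtain ⟨x, y, hxy⟩ : ∃ x y : E, ∀ μ : ℂ, ‖μ‖ ≤ 1 →
      ballInvolution c (moebius (-w) μ • v) = x + μ • y := by
    set s : ℂ := ((√(1 - ‖c‖ ^ 2) : ℝ) : ℂ) with hs
    set X : E := (((1 + √(1 - ‖c‖ ^ 2))⁻¹ : ℝ) : ℂ) • c with hX
    refine ⟨X + (s / (1 - (starRingEnd ℂ) w * w)) • (X - w • v),
      (s / (1 - (starRingEnd ℂ) w * w)) • ((starRingEnd ℂ) w • X - v), fun μ hμ => ?_⟩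
    have hD := one_sub_conj_mul_ne_zero hw' hμ
    simp only [map_neg, neg_mul, sub_neg_eq_add] at hD
    have hD' : 1 + μ * (starRingEnd ℂ) w ≠ 0 := by rwa [mul_comm μ]
    rw [ballInvolution, ← hs, ← hX, inner_smul_right, hcv]
    have e : 1 - moebius (-w) μ * (starRingEnd ℂ) w =
        (1 - (starRingEnd ℂ) w * w) / (1 + (starRingEnd ℂ) w * μ) := by
      simp only [moebius, map_neg, neg_mul, sub_neg_eq_add]
      field_simp
      ring
    have e' : moebius (-w) μ = (μ + w) / (1 + (starRingEnd ℂ) w * μ) := by simp [moebius]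
    rw [e, e']
    clear_value X s
    generalize (starRingEnd ℂ) w = w' at *
    generalize 1 - w' * w = k at *
    have t1 : s / (k / (1 + w' * μ)) = s / k * (1 + w' * μ) := by field_simp
    have t2 : s / k * (1 + w' * μ) * ((μ + w) / (1 + w' * μ)) = s / k * (μ + w) := by field_simp
    rw [t1, smul_sub, smul_smul, t2]
    module
  obtain ⟨h1, h2⟩ := inner_eq_zero_of_norm_add_smul_eq_one (x := x) (y := y) fun ν hν => by
    rw [← hxy ν hν.le]
    apply norm_ballInvolution_eq_one hc
    rw [norm_smul, hv, mul_one, norm_moebius_eq_one hw' hν]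
  obtain ⟨α, ζ, hα, hζ, hαζ⟩ := exists_moebius_comp hw hδ
  refine ⟨x, ζ • y, α, hα, by rw [inner_smul_right, h1, mul_zero],
    by rw [norm_smul, hζ, one_mul, h2], fun z hz => ?_⟩
  have hm := norm_moebius_le_one hδ hz
  rw [← moebius_neg_moebius hw hm, hxy _ (norm_moebius_le_one hw hm), hαζ z hz, smul_smul,
    mul_comm]

/-- With β = tα the equation becomes real in t: its left side is 1 at t = 0 and (A-1)(1-|α|²) ≤ 0 at
t = 1. -/
theorem exists_quadratic_root {α : ℂ} {A : ℝ} (hα : ‖α‖ < 1) (hA : A ≤ 1) :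
    ∃ β : ℂ, ‖β‖ < 1 ∧
      (starRingEnd ℂ) α * β ^ 2 - (2 - A * (1 - (starRingEnd ℂ) α * α)) * β + α = 0 := by
  have hc : ContinuousOn (fun t : ℝ => ‖α‖ ^ 2 * t ^ 2 - (2 - A * (1 - ‖α‖ ^ 2)) * t + 1)
      (Set.Icc 0 1) := by fun_prop
  have h0 : (0 : ℝ) ∈ Set.Icc (‖α‖ ^ 2 * 1 ^ 2 - (2 - A * (1 - ‖α‖ ^ 2)) * 1 + 1)
      (‖α‖ ^ 2 * 0 ^ 2 - (2 - A * (1 - ‖α‖ ^ 2)) * 0 + 1) := by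
    constructor
    · nlinarith [mul_nonneg (sub_nonneg.mpr hA)
        (by nlinarith [norm_nonneg α] : 0 ≤ 1 - ‖α‖ ^ 2)]
    · norm_num
  obtain ⟨t, ⟨ht0, ht1⟩, ht⟩ := intermediate_value_Icc' zero_le_one hc h0
  refine ⟨t * α, ?_, ?_⟩
  · rw [norm_mul, Complex.norm_real, Real.norm_eq_abs, abs_of_nonneg ht0]
    nlinarith [norm_nonneg α]
  · have h2 : (starRingEnd ℂ) α * α = ((‖α‖ ^ 2 : ℝ) : ℂ) := by
      rw [mul_comm, Complex.mul_conj, Complex.normSq_eq_norm_sq]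
    have ht' : ((‖α‖ ^ 2 : ℝ) : ℂ) * t ^ 2 - (2 - A * (1 - ((‖α‖ ^ 2 : ℝ) : ℂ))) * t + 1 = 0 := by
      exact_mod_cast congrArg (fun r : ℝ => (r : ℂ)) ht
    rw [← h2] at ht'
    linear_combination α * ht'

theorem norm_add_moebius_smul_sq {p e : E} {α z : ℂ} (hpe : inner ℂ p e = 0) :
    ‖p + moebius α z • e‖ ^ 2 = ‖p‖ ^ 2 + ‖moebius α z‖ ^ 2 * ‖e‖ ^ 2 := by
  rw [norm_add_sq (𝕜 := ℂ), inner_smul_right, hpe, norm_smul, mul_pow]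
  simp

/-- Up to automorphisms of the disc and of the ball, `z ↦ z (p + m_α(z) e)` is
`ν ↦ ν x + ν² y` with orthogonal `x` and `y`. -/
theorem exists_quadratic_normal_form {p e : E} {α : ℂ} (hα : ‖α‖ < 1) (hpe : inner ℂ p e = 0)
    (hn : ‖p‖ ^ 2 + ‖e‖ ^ 2 = 1) :
    ∃ (β : ℂ) (a x y : E), ‖β‖ < 1 ∧ ‖a‖ < 1 ∧ inner ℂ x y = 0 ∧ ‖x‖ ^ 2 + ‖y‖ ^ 2 = 1 ∧
      ∀ z, ‖z‖ ≤ 1 → ballInvolution a (z • (p + moebius α z • e)) =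
        moebius β z • x + moebius β z ^ 2 • y := by
  have hep : inner ℂ e p = (0 : ℂ) := inner_eq_zero_symm.mp hpe
  have hpp : inner ℂ p p = ((‖p‖ ^ 2 : ℝ) : ℂ) := by
    rw [inner_self_eq_norm_sq_to_K]; simp
  have hee : inner ℂ e e = 1 - ((‖p‖ ^ 2 : ℝ) : ℂ) := by
    rw [inner_self_eq_norm_sq_to_K, ← Complex.ofReal_one, ← Complex.ofReal_sub, ← hn]; simp
  obtain ⟨β, hβ, hroot⟩ := exists_quadratic_root (A := ‖p‖ ^ 2) hα (by nlinarith [norm_nonneg e])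
  have hβ' : ‖-β‖ < 1 := by simpa using hβ
  have hle : ∀ z, ‖z‖ ≤ 1 → ‖p + moebius α z • e‖ ≤ 1 := fun z hz => by
    have h1 := norm_add_moebius_smul_sq (α := α) (z := z) hpe
    have h2 := norm_moebius_le_one hα hz
    nlinarith [norm_nonneg (moebius α z), norm_nonneg (p + moebius α z • e),
      pow_le_one₀ (n := 2) (norm_nonneg _) h2, sq_nonneg ‖e‖]
  have heq : ∀ z, ‖z‖ = 1 → ‖z • (p + moebius α z • e)‖ = 1 := fun z hz => by
    have h1 := norm_add_moebius_smul_sq (α := α) (z := z) hpe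
    rw [norm_moebius_eq_one hα hz, one_pow, one_mul, hn] at h1
    rw [norm_smul, hz, one_mul]
    exact (pow_eq_one_iff_of_nonneg (norm_nonneg _) two_ne_zero).mp h1
  -- The centre is the point of the curve at z = β, so the transformed curve vanishes there.
  set a : E := β • (p + moebius α β • e) with ha_def
  have ha : ‖a‖ < 1 := by
    rw [ha_def, norm_smul]
    exact (mul_le_of_le_one_right (norm_nonneg _) (hle β hβ.le)).trans_lt hβ
  have hαβ := one_sub_conj_mul_ne_zero hα hβ.le
  have hαβ' := one_sub_mul_conj_ne_zero hα hβ.le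
  have hm : (1 - ((‖p‖ ^ 2 : ℝ) : ℂ)) * moebius α β = ((‖p‖ ^ 2 : ℝ) : ℂ) * α - β := by
    rw [moebius]
    field_simp
    linear_combination -hroot
  have hm' : (1 - ((‖p‖ ^ 2 : ℝ) : ℂ)) * (starRingEnd ℂ) (moebius α β) =
      ((‖p‖ ^ 2 : ℝ) : ℂ) * (starRingEnd ℂ) α - (starRingEnd ℂ) β := by
    have := congrArg (starRingEnd ℂ) hm
    simpa only [map_mul, map_sub, map_one, Complex.conj_ofReal] using this
  have hroot' := congrArg (starRingEnd ℂ) hroot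
  simp only [map_mul, map_sub, map_add, map_one, map_pow, map_zero, Complex.conj_ofReal,
    Complex.conj_conj, map_ofNat] at hroot'
  -- This is what the equation for β is for: the numerator becomes a perfect square, and the
  -- transformed curve, whose only pole is now a double one at 1/β̄, is a polynomial of degree at
  -- most 2 in ν = m_β(z).
  have hD : ∀ z, ‖z‖ ≤ 1 → 1 - inner ℂ a (z • (p + moebius α z • e)) =
      (1 - (starRingEnd ℂ) β * z) ^ 2 / (1 - (starRingEnd ℂ) α * z) := fun z hz => by
    have hαz := one_sub_conj_mul_ne_zero hα hz
    have hαz' := one_sub_mul_conj_ne_zero hα hz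
    have h1 : inner ℂ a (z • (p + moebius α z • e)) = (starRingEnd ℂ) β * z *
        (((‖p‖ ^ 2 : ℝ) : ℂ) + (((‖p‖ ^ 2 : ℝ) : ℂ) * (starRingEnd ℂ) α - (starRingEnd ℂ) β) *
          moebius α z) := by
      simp only [ha_def, inner_smul_left, inner_smul_right, inner_add_left, inner_add_right, hpe,
        hep, hpp, hee, ← hm']
      ring
    rw [h1, moebius]
    field_simp
    linear_combination (-z) * hroot'
  have hk := one_sub_conj_mul_ne_zero hβ hβ.le
  obtain ⟨o, x, y, hxy⟩ : ∃ o x y : E, ∀ ν : ℂ, ‖ν‖ ≤ 1 →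
      ballInvolution a (moebius (-β) ν • (p + moebius α (moebius (-β) ν) • e)) =
        o + ν • x + ν ^ 2 • y := by
    set s : ℂ := ((√(1 - ‖a‖ ^ 2) : ℝ) : ℂ) with hs
    set X : E := (((1 + √(1 - ‖a‖ ^ 2))⁻¹ : ℝ) : ℂ) • a with hX
    set α' := (starRingEnd ℂ) α
    set β' := (starRingEnd ℂ) β with hβ'_def
    set r : ℂ := s / (1 - β' * β) ^ 2
    refine ⟨X + r • ((1 - α' * β) • X - β • ((1 - α' * β) • p + (β - α) • e)),
      r • ((β' * (1 - α' * β) + (β' - α')) • X - ((1 - α' * β) • p + (β - α) • e)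
        - β • ((β' - α') • p + (1 - α * β') • e)),
      r • ((β' * (β' - α')) • X - ((β' - α') • p + (1 - α * β') • e)), fun ν hν => ?_⟩
    have hz := norm_moebius_le_one hβ' hν
    have h1 : 1 + β' * ν ≠ 0 := by simpa using one_sub_conj_mul_ne_zero hβ' hν
    have h1' : 1 + ν * β' ≠ 0 := by rwa [mul_comm ν]
    have h2 := one_sub_conj_mul_ne_zero hα hz
    have e1 : moebius (-β) ν = (ν + β) / (1 + β' * ν) := by simp [moebius, hβ'_def]
    have e2 : 1 - β' * moebius (-β) ν = (1 - β' * β) / (1 + β' * ν) := by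
      rw [e1]
      field_simp
      ring
    have e3 : 1 - α' * moebius (-β) ν =
        (1 - α' * β + (β' - α') * ν) / (1 + β' * ν) := by
      rw [e1]
      field_simp
      ring
    have h3 : 1 - α' * β + (β' - α') * ν ≠ 0 := by
      intro h
      exact h2 (by rw [e3, h, zero_div])
    rw [ballInvolution, ← hs, ← hX, hD _ hz, moebius.eq_1 α, e2, e3, e1]
    have t1 : s / (((1 - β' * β) / (1 + β' * ν)) ^ 2 /
        ((1 - α' * β + (β' - α') * ν) / (1 + β' * ν))) =
        r * ((1 + β' * ν) * (1 - α' * β + (β' - α') * ν)) := by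
      simp only [r]
      generalize 1 - β' * β = k at *
      generalize 1 - α' * β + (β' - α') * ν = N at *
      generalize 1 + β' * ν = l at *
      field_simp
    have t2 : r * ((1 + β' * ν) * (1 - α' * β + (β' - α') * ν)) * ((ν + β) / (1 + β' * ν)) =
        r * ((ν + β) * (1 - α' * β + (β' - α') * ν)) := by
      field_simp
    have t3 : r * ((ν + β) * (1 - α' * β + (β' - α') * ν)) *
        (((ν + β) / (1 + β' * ν) - α) / ((1 - α' * β + (β' - α') * ν) / (1 + β' * ν))) =
        r * ((ν + β) * (β - α + (1 - α * β') * ν)) := by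
      have t4 : (ν + β) / (1 + β' * ν) - α = (β - α + (1 - α * β') * ν) / (1 + β' * ν) := by
        field_simp
        ring
      rw [t4, div_div_div_cancel_right₀ h1]
      generalize 1 - α' * β + (β' - α') * ν = N at *
      field_simp
    clear_value X r
    rw [t1, smul_sub, smul_smul, t2, smul_add, smul_smul, t3]
    module
  have ho : o = 0 := by
    have h := hxy 0 (by simp)
    have h0 : moebius (-β) 0 = β := by simp [moebius]
    rw [h0, ← ha_def, ballInvolution_self ha] at h
    simpa using h.symm
  -- On the unit circle ν x + ν² y = ν (x + ν y) has norm one.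
  obtain ⟨h1, h2⟩ := inner_eq_zero_of_norm_add_smul_eq_one (x := x) (y := y) fun ν hν => by
    have h := norm_ballInvolution_eq_one ha (heq _ (norm_moebius_eq_one hβ' hν))
    rw [hxy ν hν.le, ho, zero_add, pow_two, mul_smul, ← smul_add, norm_smul, hν, one_mul] at h
    exact h
  refine ⟨β, a, x, y, hβ, ha, h1, h2, fun z hz => ?_⟩
  have h := hxy _ (norm_moebius_le_one hβ hz)
  rwa [moebius_neg_moebius hβ hz, ho, zero_add] at h

end Forms

/-! ### Schwarz lemma for maps into the ball -/

section Schwarz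

variable {E : Type*} [NormedAddCommGroup E] [InnerProductSpace ℂ E] [CompleteSpace E]

/-- A holomorphic map from the disc to the ball that vanishes at the origin is `z ↦ z g(z)`, where
`g` is either constant of norm one or a holomorphic map from the disc to the ball. -/
theorem exists_smul_of_mapsTo_ball {f : ℂ → E} (hd : DifferentiableOn ℂ f disc)
    (hm : Set.MapsTo f disc (Metric.ball 0 1)) (h0 : f 0 = 0) :
    ∃ g : ℂ → E, (∀ z ∈ disc, f z = z • g z) ∧
      ((∃ v, ‖v‖ = 1 ∧ ∀ z ∈ disc, g z = v) ∨
        DifferentiableOn ℂ g disc ∧ Set.MapsTo g disc (Metric.ball 0 1)) := by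
  -- The real structure makes the norm strictly convex, so the maximum principle yields a constant
  -- map and not merely a constant norm.
  let _ : InnerProductSpace ℝ E := InnerProductSpace.complexToReal
  have hgd : DifferentiableOn ℂ (dslope f 0) disc :=
    (Complex.differentiableOn_dslope (Metric.ball_mem_nhds 0 one_pos)).mpr hd
  have hle : ∀ z ∈ disc, ‖dslope f 0 z‖ ≤ 1 := fun z hz => by
    have := Complex.norm_dslope_le_div_of_mapsTo_ball (R₂ := 1) hd
      (by rw [h0]; exact hm.mono_right Metric.ball_subset_closedBall) hz
    simpa using this
  refine ⟨dslope f 0, fun z _ => by simpa [h0] using (sub_smul_dslope f 0 z).symm, ?_⟩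
  by_cases h : ∃ z ∈ disc, ‖dslope f 0 z‖ = 1
  · obtain ⟨c, hc, hc1⟩ := h
    refine Or.inl ⟨_, hc1, fun z hz => ?_⟩
    exact Complex.eqOn_of_isPreconnected_of_isMaxOn_norm
      (convex_ball (0 : ℂ) 1).isPreconnected Metric.isOpen_ball hgd hc
      (fun x hx => (hle x hx).trans_eq hc1.symm) hz
  · push Not at h
    exact Or.inr ⟨hgd, fun z hz => mem_ball_zero_iff.mpr ((hle z hz).lt_of_ne (h z hz))⟩

end Schwarz

/-! ### Competitors on the closed disc and the Schur algorithm -/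

variable {n : ℕ}

/-- The neighbourhood may be shrunk to the preimage of the open ball, so a bound on the closed disc
suffices. -/
theorem isHolClosedDisc_of_norm_lt_one {U : Set ℂ} {h : ℂ → EuclideanSpace ℂ (Fin n)}
    (hU : IsOpen U) (hsub : Metric.closedBall 0 1 ⊆ U) (hd : DifferentiableOn ℂ h U)
    (hlt : ∀ z, ‖z‖ ≤ 1 → ‖h z‖ < 1) : IsHolClosedDisc (unitBall n) h :=
  ⟨U ∩ h ⁻¹' unitBall n, hd.continuousOn.isOpen_inter_preimage hU Metric.isOpen_ball,
    fun z hz => ⟨hsub hz, mem_ball_zero_iff.mpr (hlt z (mem_closedBall_zero_iff.mp hz))⟩,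
    hd.mono Set.inter_subset_left, fun _ hz => hz.2⟩

theorem isHolClosedDisc_moebius_smul {δ : ℂ} {v : EuclideanSpace ℂ (Fin n)} (hδ : ‖δ‖ < 1)
    (hv : ‖v‖ < 1) : IsHolClosedDisc (unitBall n) fun z => moebius δ z • v := by
  refine isHolClosedDisc_of_norm_lt_one (U := {z | 1 - (starRingEnd ℂ) δ * z ≠ 0})
    (isOpen_ne_fun (by fun_prop) (by fun_prop))
    (fun z hz => one_sub_conj_mul_ne_zero hδ (mem_closedBall_zero_iff.mp hz))
    (fun z hz => ((differentiableAt_moebius hz).smul_const v).differentiableWithinAt)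
    fun z hz => ?_
  rw [norm_smul]
  exact (mul_le_of_le_one_left (norm_nonneg _) (norm_moebius_le_one hδ hz)).trans_lt hv

theorem IsHolClosedDisc.id_smul {h : ℂ → EuclideanSpace ℂ (Fin n)}
    (hh : IsHolClosedDisc (unitBall n) h) : IsHolClosedDisc (unitBall n) fun z => z • h z := by
  obtain ⟨U, hU, hsub, hd, hm⟩ := hh
  refine isHolClosedDisc_of_norm_lt_one hU hsub (differentiableOn_id.smul hd) fun z hz => ?_
  rw [norm_smul]
  exact (mul_le_of_le_one_left (norm_nonneg _) hz).trans_lt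
    (mem_ball_zero_iff.mp (hm (hsub (mem_closedBall_zero_iff.mpr hz))))

theorem mapsTo_ballInvolution {a : EuclideanSpace ℂ (Fin n)} (ha : ‖a‖ < 1) :
    Set.MapsTo (ballInvolution a) (unitBall n) (unitBall n) := fun _ hz =>
  mem_ball_zero_iff.mpr (norm_ballInvolution_lt_one ha (mem_ball_zero_iff.mp hz))

theorem IsHolClosedDisc.ballInvolution {a : EuclideanSpace ℂ (Fin n)} (ha : ‖a‖ < 1)
    {h : ℂ → EuclideanSpace ℂ (Fin n)} (hh : IsHolClosedDisc (unitBall n) h) :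
    IsHolClosedDisc (unitBall n) fun z => ballInvolution a (h z) := by
  obtain ⟨U, hU, hsub, hd, hm⟩ := hh
  exact ⟨U, hU, hsub, (differentiableOn_ballInvolution ha).comp hd hm,
    (mapsTo_ballInvolution ha).comp hm⟩

theorem ballInvolution_ballInvolution_of_mem {a z : EuclideanSpace ℂ (Fin n)} (ha : ‖a‖ < 1)
    (hz : z ∈ unitBall n) : BallExtremals.ballInvolution a (BallExtremals.ballInvolution a z) = z :=
  ballInvolution_ballInvolution ha (one_sub_inner_ne_zero ha (mem_ball_zero_iff.mp hz).le)

/-- Two steps of the Schur algorithm, applied to a `3`-extremal of the ball. -/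
theorem IsExtremal.exists_schur_form {f : ℂ → EuclideanSpace ℂ (Fin n)}
    (hf : IsExtremal 3 (unitBall n) f) :
    ∃ a : EuclideanSpace ℂ (Fin n), ‖a‖ < 1 ∧
      ((∃ v : EuclideanSpace ℂ (Fin n), ‖v‖ = 1 ∧ ∀ z ∈ disc, ballInvolution a (f z) = z • v) ∨
        ∃ (c v : EuclideanSpace ℂ (Fin n)) (δ : ℂ), ‖c‖ < 1 ∧ ‖v‖ = 1 ∧ ‖δ‖ < 1 ∧
          ∀ z ∈ disc, ballInvolution a (f z) = z • ballInvolution c (moebius δ z • v)) := by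
  obtain ⟨⟨hfd, hfm⟩, hext⟩ := hf
  have h0 : (0 : ℂ) ∈ disc := by simp
  have hδ : ‖(1 / 2 : ℂ)‖ < 1 := by norm_num
  have hδ' : ‖-(1 / 2 : ℂ)‖ < 1 := by norm_num
  have hf0 : ‖f 0‖ < 1 := mem_ball_zero_iff.mp (hfm h0)
  refine ⟨f 0, hf0, ?_⟩
  obtain ⟨g, hg, hcase⟩ := exists_smul_of_mapsTo_ball
    (f := fun z => ballInvolution (f 0) (f z))
    ((differentiableOn_ballInvolution hf0).comp hfd hfm)
    ((mapsTo_ballInvolution hf0).comp hfm) (ballInvolution_self hf0)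
  rcases hcase with ⟨v, hv, hgv⟩ | ⟨hgd, hgm⟩
  · exact Or.inl ⟨v, hv, fun z hz => by rw [hg z hz, hgv z hz]⟩
  refine Or.inr ?_
  have hc : ‖g (1 / 2)‖ < 1 := mem_ball_zero_iff.mp (hgm (mem_ball_zero_iff.mpr hδ))
  have hmm : Set.MapsTo (moebius (-(1 / 2))) disc disc := fun z hz =>
    mem_ball_zero_iff.mpr (norm_moebius_lt_one hδ' (mem_ball_zero_iff.mp hz))
  obtain ⟨k, hk, hcase⟩ := exists_smul_of_mapsTo_ball
    (f := fun z => ballInvolution (g (1 / 2)) (g (moebius (-(1 / 2)) z)))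
    ((differentiableOn_ballInvolution hc).comp (hgd.comp (differentiableOn_moebius hδ') hmm)
      (hgm.comp hmm))
    ((mapsTo_ballInvolution hc).comp (hgm.comp hmm))
    (by
      have : moebius (-(1 / 2)) 0 = 1 / 2 := by simp [moebius]
      simpa only [this] using ballInvolution_self hc)
  have hgk : ∀ z ∈ disc, g z =
      ballInvolution (g (1 / 2)) (moebius (1 / 2) z • k (moebius (1 / 2) z)) := fun z hz => by
    have hz1 := mem_ball_zero_iff.mp hz
    rw [← hk _ (mem_ball_zero_iff.mpr (norm_moebius_lt_one hδ hz1)),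
      moebius_neg_moebius hδ hz1.le, ballInvolution_ballInvolution_of_mem hc (hgm hz)]
  have hfg : ∀ z ∈ disc, f z = ballInvolution (f 0) (z • g z) := fun z hz => by
    rw [← hg z hz, ballInvolution_ballInvolution_of_mem hf0 (hfm hz)]
  rcases hcase with ⟨v, hv, hkv⟩ | ⟨-, hkm⟩
  · refine ⟨g (1 / 2), v, 1 / 2, hc, hv, hδ, fun z hz => ?_⟩
    rw [hg z hz, hgk z hz, hkv _ (mem_ball_zero_iff.mpr
      (norm_moebius_lt_one hδ (mem_ball_zero_iff.mp hz)))]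
  -- Freeze k at its value for the node -1/2, a vector of norm less than 1. The factors z and
  -- m_{1/2}(z) vanish at 0 and 1/2, so the values there do not depend on k.
  · exfalso
    have hmem : moebius (1 / 2) (-(1 / 2)) ∈ disc :=
      mem_ball_zero_iff.mpr (norm_moebius_lt_one hδ hδ')
    have hv := mem_ball_zero_iff.mp (hkm hmem)
    refine (hext ![0, 1 / 2, -(1 / 2)] ?_ ?_).2 ⟨_, IsHolClosedDisc.ballInvolution hf0
      (IsHolClosedDisc.ballInvolution hc (isHolClosedDisc_moebius_smul hδ hv)).id_smul, ?_⟩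
    · intro i j hij
      fin_cases i <;> fin_cases j <;> simp at hij ⊢ <;> norm_num [Complex.ext_iff] at hij
    · intro j
      fin_cases j
      · exact h0
      · exact mem_ball_zero_iff.mpr hδ
      · exact mem_ball_zero_iff.mpr hδ'
    · intro j
      fin_cases j
      · show BallExtremals.ballInvolution (f 0) ((0 : ℂ) • _) = f 0
        rw [zero_smul, ← zero_smul ℂ (g 0), ← hfg 0 h0]
      · show BallExtremals.ballInvolution (f 0) ((1 / 2 : ℂ) • _) = f (1 / 2)
        have h := hgk (1 / 2) (mem_ball_zero_iff.mpr hδ)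
        rw [moebius_self, zero_smul] at h
        have h2 := hfg (1 / 2) (mem_ball_zero_iff.mpr hδ)
        have h3 : moebius (1 / 2) (1 / 2) • k (moebius (1 / 2) (-(1 / 2))) = 0 := by
          rw [moebius_self, zero_smul]
        rw [h, ← h3] at h2
        exact h2.symm
      · show BallExtremals.ballInvolution (f 0) ((-(1 / 2) : ℂ) • _) = f (-(1 / 2))
        have h2 := hfg (-(1 / 2)) (mem_ball_zero_iff.mpr hδ')
        rw [hgk (-(1 / 2)) (mem_ball_zero_iff.mpr hδ')] at h2
        exact h2.symm

/-! ### The left inverse of the quadratic curve -/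

section LeftInverse

variable {E : Type*} [NormedAddCommGroup E] [InnerProductSpace ℂ E]

/-- A left inverse of `ν ↦ ν x + ν² y`, up to the degree two Blaschke product `ν²`. -/
noncomputable def quadraticLeftInverse (x y z : E) : ℂ :=
  (inner ℂ (((‖x‖⁻¹ : ℝ) : ℂ) • x) z ^ 2 + 2 * inner ℂ y z) / ((1 + ‖y‖ ^ 2 : ℝ) : ℂ)

theorem differentiable_quadraticLeftInverse (x y : E) :
    Differentiable ℂ (quadraticLeftInverse x y) := by
  have h : ∀ a : E, Differentiable ℂ fun z => (inner ℂ a z : ℂ) := fun a =>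
    (innerSL ℂ a).differentiable
  have h2 := ((h (((‖x‖⁻¹ : ℝ) : ℂ) • x)).pow 2).add ((h y).const_mul 2)
  have h3 := h2.mul_const (((1 + ‖y‖ ^ 2 : ℝ) : ℂ)⁻¹)
  unfold quadraticLeftInverse
  simp only [div_eq_mul_inv]
  exact h3

theorem norm_inv_norm_smul_le_one (x : E) : ‖((‖x‖⁻¹ : ℝ) : ℂ) • x‖ ≤ 1 := by
  rw [norm_smul, Complex.norm_real, norm_inv, norm_norm]
  exact inv_mul_le_one

theorem norm_smul_inv_norm_smul (x : E) : ((‖x‖ : ℝ) : ℂ) • ((‖x‖⁻¹ : ℝ) : ℂ) • x = x := by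
  rcases eq_or_ne x 0 with rfl | hx
  · simp
  · rw [smul_smul, ← Complex.ofReal_mul, mul_inv_cancel₀ (norm_ne_zero_iff.mpr hx),
      Complex.ofReal_one, one_smul]

/-- With u, w the components of z along the normalised x, y, AM-GM and Bessel give |u|² + 2‖y‖|w| ≤
|u|² + |w|² + ‖y‖² < 1 + ‖y‖². -/
theorem norm_quadraticLeftInverse_lt_one {x y z : E} (hxy : inner ℂ x y = 0) (hz : ‖z‖ < 1) :
    ‖quadraticLeftInverse x y z‖ < 1 := by
  set y' : E := ((‖y‖⁻¹ : ℝ) : ℂ) • y with hy'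
  have hb := norm_inner_sq_add_norm_inner_sq_le (norm_inv_norm_smul_le_one x)
    (norm_inv_norm_smul_le_one y)
    (by rw [inner_smul_left, inner_smul_right, hxy, mul_zero, mul_zero]) z
  have hyz : ‖(inner ℂ y z : ℂ)‖ = ‖y‖ * ‖(inner ℂ y' z : ℂ)‖ := by
    conv_lhs => rw [← norm_smul_inv_norm_smul y]
    rw [inner_smul_left, norm_mul, Complex.norm_conj, Complex.norm_real, norm_norm]
  have hpos : 0 < 1 + ‖y‖ ^ 2 := by positivity
  rw [quadraticLeftInverse, norm_div, Complex.norm_real, Real.norm_of_nonneg hpos.le,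
    div_lt_one hpos]
  refine (norm_add_le _ _).trans_lt ?_
  rw [norm_pow, norm_mul, hyz, Complex.norm_ofNat]
  nlinarith [sq_nonneg (‖y‖ - ‖(inner ℂ y' z : ℂ)‖), norm_nonneg z]

/-- The numerator is ν²(‖x‖² + 2‖y‖²) = ν²(1 + ‖y‖²). -/
theorem quadraticLeftInverse_apply {x y : E} (hxy : inner ℂ x y = 0)
    (hn : ‖x‖ ^ 2 + ‖y‖ ^ 2 = 1) (ν : ℂ) :
    quadraticLeftInverse x y (ν • x + ν ^ 2 • y) = ν ^ 2 := by
  have hyx : inner ℂ y x = (0 : ℂ) := inner_eq_zero_symm.mp hxy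
  have hx : ((‖x‖⁻¹ : ℝ) : ℂ) * ((‖x‖ : ℝ) : ℂ) ^ 2 = ((‖x‖ : ℝ) : ℂ) := by
    rcases eq_or_ne x 0 with rfl | hx
    · simp
    · have : ((‖x‖ : ℝ) : ℂ) ≠ 0 := by exact_mod_cast norm_ne_zero_iff.mpr hx
      push_cast
      field_simp
  have hpos : ((1 + ‖y‖ ^ 2 : ℝ) : ℂ) ≠ 0 := by
    exact_mod_cast (by positivity : 1 + ‖y‖ ^ 2 ≠ 0)
  have hn' : ((‖x‖ : ℝ) : ℂ) ^ 2 + ((‖y‖ : ℝ) : ℂ) ^ 2 = 1 := by exact_mod_cast hn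
  have h1 : inner ℂ (((‖x‖⁻¹ : ℝ) : ℂ) • x) (ν • x + ν ^ 2 • y) = ν * ((‖x‖ : ℝ) : ℂ) := by
    rw [inner_add_right, inner_smul_right, inner_smul_right, inner_smul_left, inner_smul_left,
      hxy, Complex.conj_ofReal, inner_self_eq_norm_sq_to_K, mul_zero, mul_zero, add_zero]
    exact congrArg _ hx
  have h2 : inner ℂ y (ν • x + ν ^ 2 • y) = ν ^ 2 * ((‖y‖ : ℝ) : ℂ) ^ 2 := by
    rw [inner_add_right, inner_smul_right, inner_smul_right, hyx, inner_self_eq_norm_sq_to_K,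
      mul_zero, zero_add]
    rfl
  rw [quadraticLeftInverse, h1, h2, div_eq_iff hpos]
  push_cast
  linear_combination ν ^ 2 * hn'

end LeftInverse

theorem IsExtremal.exists_leftInverse {f : ℂ → EuclideanSpace ℂ (Fin n)}
    (hf : IsExtremal 3 (unitBall n) f) : ∃ F, IsLeftInverse 3 (unitBall n) f F := by
  obtain ⟨a, ha, ⟨v, hv, hfv⟩ | ⟨c, v, δ, hc, hv, hδ, hfv⟩⟩ := hf.exists_schur_form
  · have hF : ∀ z ∈ disc, inner ℂ v (ballInvolution a (f z)) = z := fun z hz => by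
      rw [hfv z hz, inner_smul_right, inner_self_eq_norm_sq_to_K, hv]
      simp
    refine ⟨fun z => inner ℂ v (ballInvolution a z),
      (innerSL ℂ v).differentiable.comp_differentiableOn (differentiableOn_ballInvolution ha),
      fun z hz => ?_, ⟨1, by norm_num, 1, fun _ => 0, by simp, by simp, fun z hz => ?_⟩, ?_⟩
    · have h := mem_ball_zero_iff.mp (mapsTo_ballInvolution ha hz)
      have h2 := norm_inner_le_norm (𝕜 := ℂ) v (ballInvolution a z)
      rw [hv, one_mul] at h2
      exact mem_ball_zero_iff.mpr (h2.trans_lt h)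
    · simp [hF z hz, moebius]
    · rintro ⟨w, hw⟩
      have h0 := hw 0 (by simp)
      have h1 := hw (1 / 2) (by norm_num)
      rw [Function.comp_apply, hF _ (by simp)] at h0
      rw [Function.comp_apply, hF _ (by norm_num), ← h0] at h1
      norm_num at h1
  · obtain ⟨p, e, α, hα, hpe, hn, hform⟩ := exists_ballInvolution_moebius_smul_eq hc hv hδ
    obtain ⟨β, b, x, y, hβ, hb, hxy, hxyn, hquad⟩ := exists_quadratic_normal_form hα hpe hn
    have hF : ∀ z ∈ disc, quadraticLeftInverse x y (ballInvolution b (ballInvolution a (f z))) =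
        moebius β z ^ 2 := fun z hz => by
      have hz1 := (mem_ball_zero_iff.mp hz).le
      rw [hfv z hz, hform z hz1, hquad z hz1, quadraticLeftInverse_apply hxy hxyn]
    refine ⟨fun z => quadraticLeftInverse x y (ballInvolution b (ballInvolution a z)),
      (differentiable_quadraticLeftInverse x y).comp_differentiableOn
        ((differentiableOn_ballInvolution hb).comp (differentiableOn_ballInvolution ha)
          (mapsTo_ballInvolution ha)),
      fun z hz => ?_, ⟨2, le_rfl, 1, fun _ => β, by simp, by simpa using hβ, fun z hz => ?_⟩, ?_⟩
    · exact mem_ball_zero_iff.mpr (norm_quadraticLeftInverse_lt_one hxy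
        (mem_ball_zero_iff.mp (mapsTo_ballInvolution hb (mapsTo_ballInvolution ha hz))))
    · simp [hF z hz]
    -- The composition takes the value 0 at β and 1/4 at m_{-β}(1/2).
    · rintro ⟨w, hw⟩
      have hβ' : ‖-β‖ < 1 := by simpa using hβ
      have hh : ‖(1 / 2 : ℂ)‖ < 1 := by norm_num
      have h0 := hw β (by simpa using hβ)
      have hmem : moebius (-β) (1 / 2) ∈ disc :=
        mem_ball_zero_iff.mpr (norm_moebius_lt_one hβ' hh)
      have h1 := hw _ hmem
      rw [Function.comp_apply, hF _ (by simpa using hβ), moebius_self] at h0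
      rw [Function.comp_apply, hF _ hmem, moebius_moebius_neg hβ hh.le, ← h0] at h1
      norm_num at h1

end BallExtremals

theorem mainTheorem1 (n : ℕ) (f : ℂ → EuclideanSpace ℂ (Fin n))
    (hf : BallExtremals.IsExtremal 3 (BallExtremals.unitBall n) f) :
    BallExtremals.IsGeodesic 3 (BallExtremals.unitBall n) f :=
  ⟨hf.1, hf.exists_leftInverse⟩
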